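/- Let $M$ be a model category, i.e. a category with all small limits and colimits and with classes of weak equivalences, cofibrations and fibrations satisfying Quillen's axioms (two-out-of-three, retracts, lifting, factorization), and let $A$ be an object of $M$. Let $A\downarrow M$ be the undercategory: its objects are the morphisms $A\to B$ of $M$, and its morphisms from $A\to B$ to $A\to C$ are the morphisms $f\colon B\to C$ of $M$ commuting with the maps from $A$. Then $A\downarrow M$ has all small limits and colimits, and it has a model structure in which a morphism $f\colon (A\to B)\to (A\to C)$ is a weak equivalence, cofibration or fibration if and only if $f\colon B\to C$ is a weak equivalence, cofibration or fibration, respectively, in $M$. (If the factorizations in $M$ can be chosen functorially, then so can those in $A\downarrow M$; thus the statement holds whether or not functoriality of factorizations is part of the definition of a model category.) Moreover: 1. if $M$ is proper, then so is $A\downarrow M$; 2. if $M$ is cofibrantly generated, then so is $A\downarrow M$; 3. if $M$ is cellular, then so is $A\downarrow M$. The terms are used as follows. - A model category is *proper* if weak equivalences are closed under pushout along cofibrations and under pullback along fibrations. - For a set $I$ of maps, a *relative $I$-cell complex* is a transfinite composition of pushouts of elements of $I$. A *presentation* of a relative $I$-cell complex $X\to Y$ is an expression of it as the composition of a transfinite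 sequence $X=X_0\to X_1\to\cdots$, continuous at limit ordinals, with chosen pushout squares exhibiting each $X_\beta\to X_{\beta+1}$ as a pushout of a coproduct of a family of elements of $I$ (the cells attached at stage $\beta$). A *subcomplex* is a presented relative $I$-cell complex $X\to Z$ of the same length, whose cells at each stage form a subset of the cells of $X\to Y$ at that stage, together with a map of sequences under $X$ that is compatible with the attaching maps and the characteristic maps of the cells; its *size* is the cardinality of its set of cells. - An object $W$ is *small relative to* a class $D$ of maps if there is a cardinal $\kappa$ such that for every regular cardinal $\lambda\ge\kappa$ and every $\lambda$-sequence $X_0\to X_1\to\cdots$ (continuous at limit ordinals) with all $X_\beta\to X_{\beta+1}$ in $D$, the map $\operatorname{colim}_{\beta<\lambda}\mathrm{Hom}(W,X_\beta)\to\mathrm{Hom}(W,\operatorname{colim}_{\beta<\lambda}X_\beta)$ is bijective. - A model category is *cofibrantly generated* by sets of maps $I$ and $J$ if the domains of the elements of $I$ (resp. $J$) are small relative to the relative $I$-cell (resp. $J$-cell) complexes, the fibrations are exactly the maps with the right lifting property with respect to $J$, and the trivial fibrations are exactly the maps with the right lifting property with respect to $I$. It is *cofibrantly generated* if such sets exist.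 - An object $W$ is *compact* (relative to $I$) if there is a cardinal $\gamma$ such that for every presented relative $I$-cell complex $X\to Y$ every map $W\to Y$ factors through a subcomplex of size at most $\gamma$. - A map $f\colon X\to Y$ is an *effective monomorphism* if it is the equalizer of the two inclusions $Y\rightrightarrows Y\amalg_X Y$. - A model category is *cellular* if it is cofibrantly generated by some sets $I$ and $J$ such that the domains and codomains of the elements of $I$ and $J$ are compact relative to $I$, the domains of the elements of $J$ are small relative to the relative $I$-cell complexes, and all cofibrations are effective monomorphisms. -/

import Mathlib

open CategoryTheory Limits HomotopicalAlgebra Opposite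

universe v u

namespace UnderModel

section Proper

variable (C : Type u) [Category.{v} C] [ModelCategory C]

/-- Weak equivalences are closed under pushout along cofibrations. -/
def IsLeftProper : Prop :=
  ∀ ⦃X Y Z P : C⦄ ⦃w : X ⟶ Y⦄ ⦃i : X ⟶ Z⦄ ⦃i' : Y ⟶ P⦄ ⦃w' : Z ⟶ P⦄,
    IsPushout w i i' w' → weakEquivalences C w → cofibrations C i → weakEquivalences C w'

/-- Weak equivalences are closed under pullback along fibrations. -/
def IsRightProper : Prop :=
  ∀ ⦃P X Y Z : C⦄ ⦃w' : P ⟶ Y⦄ ⦃p' : P ⟶ X⦄ ⦃p : Y ⟶ Z⦄ ⦃w : X ⟶ Z⦄,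
    IsPullback w' p' p w → weakEquivalences C w → fibrations C p → weakEquivalences C w'

/-- A model category is proper if it is both left and right proper. -/
def IsProper : Prop := IsLeftProper C ∧ IsRightProper C

/-- The factorizations of the two factorization axioms can be chosen functorially. -/
def HasFunctorialFactorizations : Prop :=
  (trivialCofibrations C).HasFunctorialFactorization (fibrations C) ∧
    (cofibrations C).HasFunctorialFactorization (trivialFibrations C)

end Proper

section Cells

variable {C : Type u} [Category.{v} C]

/-- The relative `I`-cell complexes: transfinite compositions of pushouts of elements of `I`. -/
def relativeCells (I : MorphismProperty C) : MorphismProperty C :=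
  MorphismProperty.transfiniteCompositions.{v} I.pushouts

/-- `W` is small relative to `D`: there is a cardinal `κ` such that for every regular
cardinal `μ ≥ κ` and every `μ`-sequence `F` (a functor which is continuous at limit ordinals)
whose successor maps belong to `D`, the functor `Hom(W, -)` preserves the colimit of `F`,
i.e. `colim_β Hom(W, F β) ⟶ Hom(W, colim_β F β)` is bijective. -/
def IsSmallRelativeTo (W : C) (D : MorphismProperty C) : Prop :=
  ∃ κ : Cardinal.{v}, ∀ μ : Cardinal.{v}, μ.IsRegular → κ ≤ μ →
    ∀ (F : μ.ord.ToType ⥤ C), F.IsWellOrderContinuous →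
      (∀ β : μ.ord.ToType, D (F.map (homOfLE (Order.le_succ β)))) →
      PreservesColimit F (coyoneda.obj (op W))

variable {K : Type v} [LinearOrder K] [OrderBot K] [SuccOrder K] [WellFoundedLT K]
  {I : MorphismProperty C} {X Y : C} {f : X ⟶ Y}

/-- A subcomplex of a presented relative `I`-cell complex `c` on `f : X ⟶ Y`: a presented
relative cell complex `X ⟶ Z` of the same length, all of whose cells are cells of `c`
attached at the same stage (`π_injective`), with a map of sequences to the one of `c` that is
compatible with the maps from `X`, the attaching maps and the characteristic maps of cells.

The family of cells allowed at stage `j` is the family of cells of `c` at stage `j`, so that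
the field `π` of `AttachCells` becomes the inclusion of the cells of the subcomplex. -/
structure Subcomplex (c : RelativeCellComplex.{v} (fun _ : K ↦ I.homFamily) f) where
  /-- the target of the subcomplex -/
  Z : C
  /-- the underlying morphism of the subcomplex -/
  hom : X ⟶ Z
  /-- the presentation of the subcomplex -/
  complex : RelativeCellComplex.{v}
    (fun (j : K) (e : (hj : ¬ IsMax j) ×' (c.attachCells j hj).ι) ↦
      I.homFamily ((c.attachCells j e.1).π e.2)) hom
  π_injective (j : K) (hj : ¬ IsMax j) : Function.Injective (complex.attachCells j hj).π
  /-- the map of sequences -/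
  φ : complex.F ⟶ c.F
  φ_bot : complex.isoBot.inv ≫ φ.app ⊥ = c.isoBot.inv
  attaching_map (j : K) (hj : ¬ IsMax j) (i : (complex.attachCells j hj).ι) :
    ((complex.attachCells j hj).cofan₁.inj i ≫ (complex.attachCells j hj).g₁) ≫ φ.app j =
      (c.attachCells j hj).cofan₁.inj ((complex.attachCells j hj).π i).2 ≫
        (c.attachCells j hj).g₁
  characteristic_map (j : K) (hj : ¬ IsMax j) (i : (complex.attachCells j hj).ι) :
    (complex.attachCells j hj).cell i ≫ φ.app (Order.succ j) =
      (c.attachCells j hj).cell ((complex.attachCells j hj).π i).2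
  /-- the inclusion of the subcomplex, i.e. the map induced by `φ` on colimits -/
  ι : Z ⟶ Y
  incl_ι (j : K) : complex.incl.app j ≫ ι = φ.app j ≫ c.incl.app j

/-- The size of a subcomplex is the cardinality of its set of cells. -/
def Subcomplex.size {c : RelativeCellComplex.{v} (fun _ : K ↦ I.homFamily) f}
    (s : Subcomplex c) : Cardinal.{v} :=
  Cardinal.mk s.complex.Cells

/-- `W` is compact relative to `I`: there is a cardinal `γ` such that for every relative
`I`-cell complex `X ⟶ Y` with a chosen presentation, every map `W ⟶ Y` factors
through a subcomplex of size at most `γ`. -/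
def IsCompactRelativeTo (W : C) (I : MorphismProperty C) : Prop :=
  ∃ γ : Cardinal.{v}, ∀ (K : Type v) [LinearOrder K] [OrderBot K] [SuccOrder K]
    [WellFoundedLT K] (X Y : C) (f : X ⟶ Y)
    (c : RelativeCellComplex.{v} (fun _ : K ↦ I.homFamily) f) (g : W ⟶ Y),
    ∃ s : Subcomplex c, s.size ≤ γ ∧ ∃ l : W ⟶ s.Z, l ≫ s.ι = g

/-- `f : X ⟶ Y` is an effective monomorphism: it is the equalizer of the
two inclusions `Y ⇉ Y ⨿_X Y`. -/
def IsEffectiveMono {X Y : C} (f : X ⟶ Y) : Prop :=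
  ∃ (P : C) (i₁ i₂ : Y ⟶ P) (h : IsPushout f f i₁ i₂), Nonempty (IsLimit (Fork.ofι f h.w))

end Cells

section CofibrantlyGenerated

variable {C : Type u} [Category.{v} C] [ModelCategory C]

/-- The model category `C` is cofibrantly generated by the sets of maps `I` and `J`. -/
structure IsCofibrantlyGeneratedBy (I J : MorphismProperty C) : Prop where
  isSmall_I : MorphismProperty.IsSmall.{v} I
  isSmall_J : MorphismProperty.IsSmall.{v} J
  small_dom_I : ∀ ⦃X Y : C⦄ (i : X ⟶ Y), I i → IsSmallRelativeTo X (relativeCells I)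
  small_dom_J : ∀ ⦃X Y : C⦄ (j : X ⟶ Y), J j → IsSmallRelativeTo X (relativeCells J)
  fibrations_eq : fibrations C = J.rlp
  trivialFibrations_eq : trivialFibrations C = I.rlp

/-- The model category `C` is cellular with respect to the sets of maps `I` and `J`. -/
structure IsCellularBy (I J : MorphismProperty C) : Prop
    extends IsCofibrantlyGeneratedBy I J where
  compact_I : ∀ ⦃X Y : C⦄ (i : X ⟶ Y), I i →
    IsCompactRelativeTo X I ∧ IsCompactRelativeTo Y I
  compact_J : ∀ ⦃X Y : C⦄ (j : X ⟶ Y), J j →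
    IsCompactRelativeTo X I ∧ IsCompactRelativeTo Y I
  small_dom_J_I : ∀ ⦃X Y : C⦄ (j : X ⟶ Y), J j → IsSmallRelativeTo X (relativeCells I)
  effectiveMono : ∀ ⦃X Y : C⦄ (f : X ⟶ Y), cofibrations C f → IsEffectiveMono f

variable (C)

/-- The model category `C` is cofibrantly generated. -/
def IsCofibrantlyGenerated : Prop :=
  ∃ I J : MorphismProperty C, IsCofibrantlyGeneratedBy I J

/-- The model category `C` is cellular. -/
def IsCellular : Prop :=
  ∃ I J : MorphismProperty C, IsCellularBy I J

end CofibrantlyGenerated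

end UnderModel

namespace UnderModel

/-! ### Model structure, properness and effective monomorphisms under `A` -/

section ModelStructure

variable {M : Type u} [Category.{v} M] (A : M)

/-! All three classes are inverse images under the forgetful functor `Under A ⥤ M`, so
two-out-of-three and retracts are inherited. Lifts and factorizations taken in `M` acquire their
maps from `A` by composition. Properness passes up because the forgetful functor preserves pushouts
and pullbacks.

For generation, use its left adjoint `X ↦ (A ⟶ A ⨿ X)`, taking `freeMaps A I` and `freeMaps A J` as
generators; by adjunction their lifting properties are those of `I` and `J` in `M` (`rlp_freeMaps`).
The key point is that attaching a free cell in `Under A` is the same as attaching the original cell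
in `M` (`isPushout_transpose`, `isPushout_transpose_symm`). As the forgetful functor also respects
transfinite compositions, whose shapes are connected, relative cell complexes and their subcomplexes
pass between `Under A` and `M` with the same cells. Smallness and compactness of free objects then
follow by transposing maps (`isSmallRelativeTo_costar`, `isCompactRelativeTo_costar`). -/

lemma hasLiftingProperty_under {A : M} {X Y Z W : Under A} (i : X ⟶ Y) (p : Z ⟶ W)
    [HasLiftingProperty i.right p.right] : HasLiftingProperty i p where
  sq_hasLift {f g} sq := by
    have sq' : CommSq f.right i.right p.right g.right := sq.map (Under.forget A)
    exact ⟨⟨{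
      -- Any lift in `M` respects the maps from `A`, because the one into `Y` factors through `i`.
      l := Under.homMk sq'.lift (by
        rw [← Under.w i, Category.assoc, sq'.fac_left, Under.w f])
      fac_left := by ext; exact sq'.fac_left
      fac_right := by ext; exact sq'.fac_right }⟩⟩

/-- A factorization of `f.right` lifts to a factorization of `f` in the undercategory. -/
def mapFactorizationDataUnder {A : M} {W₁ W₂ : MorphismProperty M} {X Y : Under A} {f : X ⟶ Y}
    (h : MorphismProperty.MapFactorizationData W₁ W₂ f.right) :
    MorphismProperty.MapFactorizationData W₁.under W₂.under f where
  Z := Under.mk (X.hom ≫ h.i)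
  i := Under.homMk h.i
  p := Under.homMk h.p (by simp)
  fac := by ext; exact h.fac
  hi := h.hi
  hp := h.hp

instance hasFactorization_under (W₁ W₂ : MorphismProperty M) [W₁.HasFactorization W₂] :
    (W₁.under (X := A)).HasFactorization W₂.under where
  nonempty_mapFactorizationData f :=
    ⟨mapFactorizationDataUnder (MorphismProperty.factorizationData W₁ W₂ f.right)⟩

/-- The morphism of arrows of `M` underlying a morphism of arrows of `Under A`. -/
def arrowRightMap {A : M} {f g : Arrow (Under A)} (φ : f ⟶ g) :
    Arrow.mk f.hom.right ⟶ Arrow.mk g.hom.right :=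
  Arrow.homMk φ.left.right φ.right.right (congrArg CommaMorphism.right φ.w)

/-- A functorial factorization lifts to a functorial factorization in the undercategory. -/
def functorialFactorizationDataUnder {W₁ W₂ : MorphismProperty M}
    (h : W₁.FunctorialFactorizationData W₂) :
    (W₁.under (X := A)).FunctorialFactorizationData W₂.under where
  Z :=
    { obj f := Under.mk (f.left.hom ≫ (h.factorizationData f.hom.right).i)
      map φ := Under.homMk (h.mapZ (arrowRightMap φ)) (by
        dsimp
        rw [Category.assoc, h.i_mapZ, ← Category.assoc]
        exact congrArg (· ≫ _) (Under.w φ.left))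
      map_id f := by ext; exact h.mapZ_id f.hom.right
      map_comp φ ψ := by ext; exact h.mapZ_comp (arrowRightMap φ) (arrowRightMap ψ) }
  i :=
    { app f := Under.homMk (U := f.left) (h.factorizationData f.hom.right).i
      naturality f g φ := by ext; exact (h.i_mapZ (arrowRightMap φ)).symm }
  p :=
    { app f := Under.homMk (V := f.right) (h.factorizationData f.hom.right).p (by
        dsimp
        rw [Category.assoc, MorphismProperty.MapFactorizationData.fac, Under.w])
      naturality f g φ := by ext; exact h.mapZ_p (arrowRightMap φ) }
  fac := by ext f; exact (h.factorizationData f.hom.right).fac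
  hi f := (h.factorizationData f.hom.right).hi
  hp f := (h.factorizationData f.hom.right).hp

lemma hasFunctorialFactorization_under {W₁ W₂ : MorphismProperty M}
    (h : W₁.HasFunctorialFactorization W₂) :
    (W₁.under (X := A)).HasFunctorialFactorization W₂.under where
  nonempty_functorialFactorizationData :=
    ⟨functorialFactorizationDataUnder A h.nonempty_functorialFactorizationData.some⟩

/-- The pushout in `M` becomes one under `A`. The equalizer lift respects the maps from `A` because
`f.right` is a monomorphism. -/
lemma isEffectiveMono_under {A : M} {X Y : Under A} (f : X ⟶ Y) (h : IsEffectiveMono f.right) :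
    IsEffectiveMono f := by
  obtain ⟨P, i₁, i₂, sq, ⟨hf⟩⟩ := h
  have w₂ : Y.hom ≫ i₂ = Y.hom ≫ i₁ := by
    rw [← Under.w f, Category.assoc, Category.assoc, sq.w]
  let j₁ : Y ⟶ Under.mk (Y.hom ≫ i₁) := Under.homMk i₁
  let j₂ : Y ⟶ Under.mk (Y.hom ≫ i₁) := Under.homMk i₂ w₂
  have hj : f ≫ j₁ = f ≫ j₂ := by ext; exact sq.w
  have sq' : IsPushout f f j₁ j₂ := IsPushout.of_map (Under.forget A) hj sq
  refine ⟨_, j₁, j₂, sq', ⟨Fork.IsLimit.mk' _ fun s ↦ ?_⟩⟩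
  have hs : s.ι.right ≫ i₁ = s.ι.right ≫ i₂ := congrArg CommaMorphism.right s.condition
  obtain ⟨l, hl⟩ := Fork.IsLimit.lift' hf _ hs
  change l ≫ f.right = _ at hl
  have hmono {T : M} {a b : T ⟶ X.right} (hab : a ≫ f.right = b ≫ f.right) : a = b :=
    Fork.IsLimit.hom_ext hf hab
  refine ⟨Under.homMk l (hmono ?_), ?_, fun {m} hm ↦ ?_⟩
  · rw [Category.assoc, hl]
    exact (Under.w s.ι).trans (Under.w f).symm
  · ext; exact hl
  · ext
    exact hmono ((congrArg CommaMorphism.right hm).trans hl.symm)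

scoped instance categoryWithCofibrationsUnder [CategoryWithCofibrations M] :
    CategoryWithCofibrations (Under A) where
  cofibrations := (cofibrations M).under

scoped instance categoryWithFibrationsUnder [CategoryWithFibrations M] :
    CategoryWithFibrations (Under A) where
  fibrations := (fibrations M).under

scoped instance categoryWithWeakEquivalencesUnder [CategoryWithWeakEquivalences M] :
    CategoryWithWeakEquivalences (Under A) where
  weakEquivalences := (weakEquivalences M).under

lemma cofibrations_under [CategoryWithCofibrations M] :
    cofibrations (Under A) = (cofibrations M).under := rfl

lemma fibrations_under [CategoryWithFibrations M] :
    fibrations (Under A) = (fibrations M).under := rfl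

lemma weakEquivalences_under [CategoryWithWeakEquivalences M] :
    weakEquivalences (Under A) = (weakEquivalences M).under := rfl

lemma trivialCofibrations_under [CategoryWithCofibrations M] [CategoryWithWeakEquivalences M] :
    trivialCofibrations (Under A) = (trivialCofibrations M).under := rfl

lemma trivialFibrations_under [CategoryWithFibrations M] [CategoryWithWeakEquivalences M] :
    trivialFibrations (Under A) = (trivialFibrations M).under := rfl

variable [ModelCategory M]

/-- The model structure on `Under A` in which the three classes of morphisms are created by the
forgetful functor to `M`. -/
scoped instance modelCategoryUnder : ModelCategory (Under A) where
  cm1a := ⟨fun _ _ _ ↦ inferInstance⟩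
  cm2 := by rw [weakEquivalences_under, MorphismProperty.under_eq_inverseImage]; infer_instance
  cm3a := by rw [weakEquivalences_under, MorphismProperty.under_eq_inverseImage]; infer_instance
  cm3b := by rw [fibrations_under, MorphismProperty.under_eq_inverseImage]; infer_instance
  cm3c := by rw [cofibrations_under, MorphismProperty.under_eq_inverseImage]; infer_instance
  cm4a i p hi hw hp := by
    have : Cofibration i.right := ⟨hi.mem⟩
    have : WeakEquivalence i.right := ⟨hw.mem⟩
    have : Fibration p.right := ⟨hp.mem⟩
    exact hasLiftingProperty_under i p
  cm4b i p hi hp hw := by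
    have : Cofibration i.right := ⟨hi.mem⟩
    have : Fibration p.right := ⟨hp.mem⟩
    have : WeakEquivalence p.right := ⟨hw.mem⟩
    exact hasLiftingProperty_under i p
  cm5a := by rw [trivialCofibrations_under, fibrations_under]; infer_instance
  cm5b := by rw [trivialFibrations_under, cofibrations_under]; infer_instance

lemma hasFunctorialFactorizations_under (h : HasFunctorialFactorizations M) :
    HasFunctorialFactorizations (Under A) :=
  ⟨hasFunctorialFactorization_under A h.1, hasFunctorialFactorization_under A h.2⟩

lemma isProper_under (h : IsProper M) : IsProper (Under A) :=
  ⟨fun _ _ _ _ _ _ _ _ sq hw hi ↦ h.1 (sq.map (Under.forget A)) hw hi,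
    fun _ _ _ _ _ _ _ _ sq hw hp ↦ h.2 (sq.map (Under.forget A)) hw hp⟩

end ModelStructure

/-! ### Free objects under `A` and the attachment of free cells -/

noncomputable section FreeUnder

variable {M : Type u} [Category.{v} M] {A : M}

lemma isPushout_of_exists_desc {C : Type*} [Category* C] {Z X Y P : C} {f : Z ⟶ X} {g : Z ⟶ Y}
    {i₁ : X ⟶ P} {i₂ : Y ⟶ P} (w : f ≫ i₁ = g ≫ i₂)
    (desc : ∀ ⦃T : C⦄ (a : X ⟶ T) (b : Y ⟶ T), f ≫ a = g ≫ b → ∃ l, i₁ ≫ l = a ∧ i₂ ≫ l = b)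
    (hom_ext : ∀ ⦃T : C⦄ (l l' : P ⟶ T), i₁ ≫ l = i₁ ≫ l' → i₂ ≫ l = i₂ ≫ l' → l = l') :
    IsPushout f g i₁ i₂ :=
  ⟨⟨w⟩, ⟨PushoutCocone.isColimitAux' _ fun s ↦
    ⟨_, (desc s.inl s.inr s.condition).choose_spec.1,
      (desc s.inl s.inr s.condition).choose_spec.2, fun h₁ h₂ ↦ hom_ext _ _
        (h₁.trans (desc s.inl s.inr s.condition).choose_spec.1.symm)
        (h₂.trans (desc s.inl s.inr s.condition).choose_spec.2.symm)⟩⟩⟩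

section Transpose

variable [HasBinaryCoproducts M]

/-- The adjunction between `X ↦ (A ⟶ A ⨿ X)` and the forgetful functor, on morphisms. -/
def transpose {X : M} {B : Under A} : ((Under.costar A).obj X ⟶ B) ≃ (X ⟶ B.right) :=
  (Under.costarAdjForget A).homEquiv X B

lemma transpose_comp {X : M} {B C : Under A} (f : (Under.costar A).obj X ⟶ B) (g : B ⟶ C) :
    transpose (f ≫ g) = transpose f ≫ g.right :=
  (Under.costarAdjForget A).homEquiv_naturality_right f g

lemma transpose_map_comp {X Y : M} {B : Under A} (m : X ⟶ Y) (f : (Under.costar A).obj Y ⟶ B) :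
    transpose ((Under.costar A).map m ≫ f) = m ≫ transpose f :=
  (Under.costarAdjForget A).homEquiv_naturality_left m f

lemma transpose_symm_comp {X : M} {B C : Under A} (f : X ⟶ B.right) (g : B ⟶ C) :
    transpose.symm f ≫ g = transpose.symm (f ≫ g.right) :=
  ((Under.costarAdjForget A).homEquiv_naturality_right_symm f g).symm

lemma map_comp_transpose_symm {X Y : M} {B : Under A} (m : X ⟶ Y) (f : Y ⟶ B.right) :
    (Under.costar A).map m ≫ transpose.symm f = transpose.symm (m ≫ f) :=
  ((Under.costarAdjForget A).homEquiv_naturality_left_symm m f).symm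

lemma hom_comp_transpose_symm_comp {S : M} {S' B C : Under A} (e : S' ≅ (Under.costar A).obj S)
    {x : S ⟶ B.right} {φ : B ⟶ C} {y : S' ⟶ C} (h : x ≫ φ.right = transpose (e.inv ≫ y)) :
    (e.hom ≫ transpose.symm x) ≫ φ = y := by
  rw [Category.assoc, transpose_symm_comp, h, Equiv.symm_apply_apply, Iso.hom_inv_id_assoc]

/-- Maps out of the free corners are maps in `M`, and the map induced on `C` lies under `A`
automatically, since `C.hom` factors through `f`. -/
lemma isPushout_transpose_symm {X Y : M} {m : X ⟶ Y} {B C : Under A} {f : B ⟶ C}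
    {g₁ : X ⟶ B.right} {g₂ : Y ⟶ C.right} (sq : IsPushout g₁ m f.right g₂) :
    IsPushout (transpose.symm g₁) ((Under.costar A).map m) f (transpose.symm g₂) := by
  refine isPushout_of_exists_desc
    (by rw [transpose_symm_comp, map_comp_transpose_symm, sq.w]) ?_ ?_
  · intro T a b w
    have w' : g₁ ≫ a.right = m ≫ transpose b := by
      rw [← transpose_map_comp, ← w, transpose_comp, Equiv.apply_symm_apply]
    refine ⟨Under.homMk (sq.desc _ _ w') ?_, ?_, ?_⟩
    · rw [← Under.w f, Category.assoc, sq.inl_desc, Under.w]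
    · ext; exact sq.inl_desc _ _ w'
    · rw [transpose_symm_comp, Equiv.symm_apply_eq]
      exact sq.inr_desc _ _ w'
  · intro T l l' h₁ h₂
    rw [transpose_symm_comp, transpose_symm_comp] at h₂
    ext
    exact sq.hom_ext (congrArg CommaMorphism.right h₁) (transpose.symm.injective h₂)

lemma isPushout_transpose {X Y : M} {m : X ⟶ Y} {B C : Under A} {f : B ⟶ C}
    {g₁ : (Under.costar A).obj X ⟶ B} {g₂ : (Under.costar A).obj Y ⟶ C}
    (sq : IsPushout g₁ ((Under.costar A).map m) f g₂) :
    IsPushout (transpose g₁) m f.right (transpose g₂) := by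
  refine isPushout_of_exists_desc
    (by rw [← transpose_comp, ← transpose_map_comp, sq.w]) ?_ ?_
  · intro T a b w
    -- The test object `T` has no map from `A`; it receives one through `B`, so that the universal
    -- property in `Under A` applies.
    let a' : B ⟶ Under.mk (B.hom ≫ a) := Under.homMk a
    let b' : (Under.costar A).obj Y ⟶ Under.mk (B.hom ≫ a) := transpose.symm b
    have w' : g₁ ≫ a' = (Under.costar A).map m ≫ b' := by
      rw [map_comp_transpose_symm, Equiv.eq_symm_apply, transpose_comp]
      exact w
    refine ⟨(sq.desc a' b' w').right, congrArg CommaMorphism.right (sq.inl_desc a' b' w'), ?_⟩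
    rw [← transpose_comp, sq.inr_desc, Equiv.apply_symm_apply]
  · intro T l l' h₁ h₂
    have hl : C.hom ≫ l' = C.hom ≫ l := by
      rw [← Under.w f, Category.assoc, Category.assoc, h₁]
    let L : C ⟶ Under.mk (C.hom ≫ l) := Under.homMk l
    let L' : C ⟶ Under.mk (C.hom ≫ l) := Under.homMk l' hl
    have : L = L' := by
      apply sq.hom_ext
      · ext; exact h₁
      · apply transpose.injective
        rw [transpose_comp, transpose_comp]
        exact h₂
    exact congrArg CommaMorphism.right this

end Transpose

section AttachCells

variable [HasColimits M] {α : Type*} {X Y : α → M} {g : ∀ a, X a ⟶ Y a}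
  {X' Y' : α → Under A} {g' : ∀ a, X' a ⟶ Y' a}
  (e : ∀ a, Arrow.mk (g' a) ≅ Arrow.mk ((Under.costar A).map (g a)))
  {B C : Under A} {f : B ⟶ C}

/-- If the morphism of `M` underlying `f` is obtained by attaching cells `g a`, then `f` is
obtained by attaching the cells `g' a` that are isomorphic to the free morphisms on `g a`. -/
def attachCellsUnder (c : AttachCells.{v} g f.right) : AttachCells.{v} g' f :=
  -- A left adjoint preserves the two coproducts, and the attaching square transposes to a pushout;
  -- reindexing along `e` then replaces free cells by isomorphic ones.
  AttachCells.reindexCellTypes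
    (g := fun a ↦ (Under.costar A).map (g a)) (a := id) (ha := fun a ↦ (e a).symm)
    { ι := c.ι
      π := c.π
      cofan₁ := Cofan.mk ((Under.costar A).obj c.cofan₁.pt)
        fun i ↦ (Under.costar A).map (c.cofan₁.inj i)
      cofan₂ := Cofan.mk ((Under.costar A).obj c.cofan₂.pt)
        fun i ↦ (Under.costar A).map (c.cofan₂.inj i)
      isColimit₁ := isColimitCofanMkObjOfIsColimit (Under.costar A) _ _ c.isColimit₁
      isColimit₂ := isColimitCofanMkObjOfIsColimit (Under.costar A) _ _ c.isColimit₂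
      m := (Under.costar A).map c.m
      hm i := by
        change (Under.costar A).map _ ≫ _ = _ ≫ (Under.costar A).map _
        rw [← Functor.map_comp, c.hm, Functor.map_comp]
      g₁ := transpose.symm c.g₁
      g₂ := transpose.symm c.g₂
      isPushout := isPushout_transpose_symm c.isPushout }

lemma attachCellsUnder_attaching_map (c : AttachCells.{v} g f.right) (i : c.ι) :
    (attachCellsUnder e c).cofan₁.inj i ≫ (attachCellsUnder e c).g₁ =
      (e (c.π i)).hom.left ≫ transpose.symm (c.cofan₁.inj i ≫ c.g₁) := by
  rw [← map_comp_transpose_symm, ← Category.assoc]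
  rfl

lemma attachCellsUnder_cell (c : AttachCells.{v} g f.right) (i : c.ι) :
    (attachCellsUnder e c).cell i = (e (c.π i)).hom.right ≫ transpose.symm (c.cell i) := by
  rw [AttachCells.cell_def, ← map_comp_transpose_symm, ← Category.assoc]
  rfl

/-- Reduces the compatibility of a lifted attaching map with `φ` to its transpose, an equation in
`M`. -/
lemma attachCellsUnder_attaching_map_comp (c : AttachCells.{v} g f.right) (i : c.ι)
    {D : Under A} (φ : B ⟶ D) (y : X' (c.π i) ⟶ D)
    (h : (c.cofan₁.inj i ≫ c.g₁) ≫ φ.right = transpose ((e (c.π i)).inv.left ≫ y)) :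
    ((attachCellsUnder e c).cofan₁.inj i ≫ (attachCellsUnder e c).g₁) ≫ φ = y :=
  (congrArg (· ≫ φ) (attachCellsUnder_attaching_map e c i)).trans
    (hom_comp_transpose_symm_comp (Arrow.leftFunc.mapIso (e (c.π i))) h)

lemma attachCellsUnder_cell_comp (c : AttachCells.{v} g f.right) (i : c.ι)
    {D : Under A} (φ : C ⟶ D) (y : Y' (c.π i) ⟶ D)
    (h : c.cell i ≫ φ.right = transpose ((e (c.π i)).inv.right ≫ y)) :
    ((attachCellsUnder e c).cofan₂.inj i ≫ (attachCellsUnder e c).g₂) ≫ φ = y :=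
  (congrArg (· ≫ φ) (attachCellsUnder_cell e c i)).trans
    (hom_comp_transpose_symm_comp (Arrow.rightFunc.mapIso (e (c.π i))) h)

end AttachCells

section AttachCellsForget

variable [HasColimits M] {α β : Type*} {X Y : α → M} {g : ∀ a, X a ⟶ Y a}
  {X' Y' : β → Under A} {g' : ∀ b, X' b ⟶ Y' b} (p : β → α)
  (e : ∀ b, Arrow.mk (g' b) ≅ Arrow.mk ((Under.costar A).map (g (p b))))
  {B C : Under A} {f : B ⟶ C}

/-- The free object on the coproduct of the sources of the cells is the coproduct of the
sources of the free cells. -/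
def freeSigmaIso₁ (c : AttachCells.{v} g' f) :
    (Under.costar A).obj (∐ fun i : c.ι ↦ X (p (c.π i))) ≅ c.cofan₁.pt :=
  (isColimitCofanMkObjOfIsColimit (Under.costar A) _ _
    (coproductIsCoproduct fun i : c.ι ↦ X (p (c.π i)))).coconePointUniqueUpToIso
      (c.reindexCellTypes (fun a ↦ (Under.costar A).map (g a)) p e).isColimit₁

lemma map_ι_freeSigmaIso₁_hom (c : AttachCells.{v} g' f) (i : c.ι) :
    (Under.costar A).map (Sigma.ι (fun i : c.ι ↦ X (p (c.π i))) i) ≫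
      (freeSigmaIso₁ p e c).hom = (e (c.π i)).inv.left ≫ c.cofan₁.inj i :=
  IsColimit.comp_coconePointUniqueUpToIso_hom
    (isColimitCofanMkObjOfIsColimit (Under.costar A) _ _
      (coproductIsCoproduct fun i : c.ι ↦ X (p (c.π i))))
    (c.reindexCellTypes (fun a ↦ (Under.costar A).map (g a)) p e).isColimit₁ (Discrete.mk i)

/-- The free object on the coproduct of the targets of the cells is the coproduct of the
targets of the free cells. -/
def freeSigmaIso₂ (c : AttachCells.{v} g' f) :
    (Under.costar A).obj (∐ fun i : c.ι ↦ Y (p (c.π i))) ≅ c.cofan₂.pt :=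
  (isColimitCofanMkObjOfIsColimit (Under.costar A) _ _
    (coproductIsCoproduct fun i : c.ι ↦ Y (p (c.π i)))).coconePointUniqueUpToIso
      (c.reindexCellTypes (fun a ↦ (Under.costar A).map (g a)) p e).isColimit₂

lemma map_ι_freeSigmaIso₂_hom (c : AttachCells.{v} g' f) (i : c.ι) :
    (Under.costar A).map (Sigma.ι (fun i : c.ι ↦ Y (p (c.π i))) i) ≫
      (freeSigmaIso₂ p e c).hom = (e (c.π i)).inv.right ≫ c.cofan₂.inj i :=
  IsColimit.comp_coconePointUniqueUpToIso_hom
    (isColimitCofanMkObjOfIsColimit (Under.costar A) _ _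
      (coproductIsCoproduct fun i : c.ι ↦ Y (p (c.π i))))
    (c.reindexCellTypes (fun a ↦ (Under.costar A).map (g a)) p e).isColimit₂ (Discrete.mk i)

/-- Identifies `c.m` with the free map on a coproduct of maps of `M`, the form that
`isPushout_transpose` requires. -/
lemma freeSigmaIso₁_hom_m (c : AttachCells.{v} g' f) :
    (freeSigmaIso₁ p e c).hom ≫ c.m =
      (Under.costar A).map (Limits.Sigma.map fun i : c.ι ↦ g (p (c.π i))) ≫
        (freeSigmaIso₂ p e c).hom := by
  refine Cofan.IsColimit.hom_ext (isColimitCofanMkObjOfIsColimit (Under.costar A) _ _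
    (coproductIsCoproduct fun i : c.ι ↦ X (p (c.π i)))) _ _ fun i ↦ ?_
  change (Under.costar A).map (Sigma.ι (fun i : c.ι ↦ X (p (c.π i))) i) ≫ _ =
    (Under.costar A).map (Sigma.ι (fun i : c.ι ↦ X (p (c.π i))) i) ≫ _
  have w : (e (c.π i)).inv.left ≫ g' (c.π i) =
      (Under.costar A).map (g (p (c.π i))) ≫ (e (c.π i)).inv.right := (e (c.π i)).inv.w
  rw [reassoc_of% (map_ι_freeSigmaIso₁_hom p e c i), c.hm, ← Functor.map_comp_assoc, Sigma.ι_map,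
    Functor.map_comp_assoc, map_ι_freeSigmaIso₂_hom, reassoc_of% w]

/-- If `f` is obtained by attaching cells `g' b`, isomorphic to free morphisms on `g (p b)`,
then the morphism of `M` underlying `f` is obtained by attaching the cells `g (p b)`. -/
def attachCellsForget (c : AttachCells.{v} g' f) : AttachCells.{v} g f.right where
  ι := c.ι
  π i := p (c.π i)
  -- The coproducts are formed afresh in `M`: those of `c` live in `Under A`, and the forgetful
  -- functor does not preserve coproducts.
  cofan₁ := _
  cofan₂ := _
  isColimit₁ := coproductIsCoproduct fun i ↦ X (p (c.π i))
  isColimit₂ := coproductIsCoproduct fun i ↦ Y (p (c.π i))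
  m := Limits.Sigma.map fun i : c.ι ↦ g (p (c.π i))
  hm i := by simp
  g₁ := transpose ((freeSigmaIso₁ p e c).hom ≫ c.g₁)
  g₂ := transpose ((freeSigmaIso₂ p e c).hom ≫ c.g₂)
  isPushout := isPushout_transpose <|
    c.isPushout.of_iso (freeSigmaIso₁ p e c).symm (Iso.refl _) (freeSigmaIso₂ p e c).symm
      (Iso.refl _) (by simp)
      (by simp [Iso.eq_inv_comp, reassoc_of% (freeSigmaIso₁_hom_m p e c)]) (by simp) (by simp)

lemma attachCellsForget_attaching_map (c : AttachCells.{v} g' f) (i : c.ι) :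
    (attachCellsForget p e c).cofan₁.inj i ≫ (attachCellsForget p e c).g₁ =
      transpose ((e (c.π i)).inv.left ≫ c.cofan₁.inj i ≫ c.g₁) := by
  rw [← Category.assoc, ← map_ι_freeSigmaIso₁_hom, Category.assoc, transpose_map_comp]
  rfl

lemma attachCellsForget_cell (c : AttachCells.{v} g' f) (i : c.ι) :
    (attachCellsForget p e c).cell i =
      transpose ((e (c.π i)).inv.right ≫ c.cell i) := by
  rw [AttachCells.cell_def c, ← Category.assoc ((e (c.π i)).inv.right),
    ← map_ι_freeSigmaIso₂_hom, Category.assoc, transpose_map_comp]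
  rfl

end AttachCellsForget

end FreeUnder

/-! ### Transfinite compositions and cell complexes under `A` -/

noncomputable section FreeCells

variable {M : Type u} [Category.{v} M] {A : M}

section WellOrder

variable {K : Type*} [LinearOrder K] [OrderBot K]

attribute [local instance] IsFiltered.isConnected

/-- A linear order with a least element is filtered, hence connected, and the forgetful functor
preserves connected colimits. -/
instance preservesColimitsOfShape_forget_of_orderBot :
    PreservesColimitsOfShape K (Under.forget A) := inferInstance

lemma isConnected_Iio {K : Type*} [LinearOrder K] {j : K} (hj : Order.IsSuccLimit j) :
    IsConnected (Set.Iio j) := by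
  obtain ⟨i, hi⟩ := not_isMin_iff.1 hj.not_isMin
  have : Nonempty (Set.Iio j) := ⟨⟨i, hi⟩⟩
  infer_instance

instance preservesWellOrderContinuousOfShape_forget (K : Type*) [LinearOrder K] :
    PreservesWellOrderContinuousOfShape K (Under.forget A) where
  preservesColimitsOfShape _ hj := by
    have := isConnected_Iio hj
    infer_instance

lemma isWellOrderContinuous_of_comp_forget {K : Type*} [LinearOrder K] (F : K ⥤ Under A)
    (h : (F ⋙ Under.forget A).IsWellOrderContinuous) : F.IsWellOrderContinuous where
  nonempty_isColimit j hj := by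
    have := isConnected_Iio hj
    exact ⟨isColimitOfReflects (Under.forget A) (h.nonempty_isColimit j hj).some⟩

end WellOrder

section Lift

variable {K : Type*} [LinearOrder K] [OrderBot K] [SuccOrder K] [WellFoundedLT K]
  {X : Under A} {Z : M} {f : X.right ⟶ Z}

/-- The sequence of a transfinite composition starting at `X.right`, as a sequence in `Under A`. -/
def sequenceUnder (c : TransfiniteCompositionOfShape K f) : K ⥤ Under A :=
  Under.lift c.F
    { app j := X.hom ≫ c.isoBot.inv ≫ c.F.map (homOfLE bot_le)
      naturality i j φ := by
        dsimp
        rw [Category.id_comp, Category.assoc, Category.assoc, ← c.F.map_comp]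
        rfl }

lemma sequenceUnder_hom_comp_incl (c : TransfiniteCompositionOfShape K f) (j : K) :
    ((sequenceUnder c).obj j).hom ≫ c.incl.app j = X.hom ≫ f := by
  change (X.hom ≫ c.isoBot.inv ≫ c.F.map _) ≫ c.incl.app j = X.hom ≫ f
  have := c.incl.naturality (homOfLE (bot_le : ⊥ ≤ j))
  dsimp at this
  rw [Category.assoc, Category.assoc, this, Category.comp_id, c.fac]

/-- A transfinite composition in `M` starting at `X.right` lifts to `Under A`. -/
def transfiniteCompositionUnder (c : TransfiniteCompositionOfShape K f) :
    TransfiniteCompositionOfShape K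
      (Under.homMk f : X ⟶ Under.mk (X.hom ≫ f)) where
  F := sequenceUnder c
  isoBot := Under.isoMk c.isoBot (by
    change (X.hom ≫ c.isoBot.inv ≫ c.F.map (𝟙 _)) ≫ c.isoBot.hom = _
    simp)
  isWellOrderContinuous := isWellOrderContinuous_of_comp_forget _ c.isWellOrderContinuous
  incl :=
    { app j := Under.homMk (c.incl.app j) (sequenceUnder_hom_comp_incl c j)
      naturality i j φ := by ext; exact c.incl.naturality φ }
  isColimit := Under.isColimitLiftCocone _ _ _ _ (sequenceUnder_hom_comp_incl c) c.isColimit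
  fac := by ext; exact c.fac

end Lift

section Complexes

variable [HasColimits M] {K : Type*} [LinearOrder K] [OrderBot K] [SuccOrder K] [WellFoundedLT K]

/-- The relative cell complex of `M` underlying a relative cell complex of `Under A` with free
cells. -/
def relativeCellComplexForget {α β : K → Type*} {S T : ∀ j, α j → M}
    {g : ∀ j a, S j a ⟶ T j a} {S' T' : ∀ j, β j → Under A} {g' : ∀ j b, S' j b ⟶ T' j b}
    (p : ∀ j, β j → α j)
    (e : ∀ j b, Arrow.mk (g' j b) ≅ Arrow.mk ((Under.costar A).map (g j (p j b))))
    {X Y : Under A} {f : X ⟶ Y} (c : RelativeCellComplex.{v} g' f) :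
    RelativeCellComplex.{v} g f.right where
  toTransfiniteCompositionOfShape := c.toTransfiniteCompositionOfShape.map (Under.forget A)
  attachCells j hj := attachCellsForget (p j) (e j) (c.attachCells j hj)

variable {α : K → Type*} {S T : ∀ j, α j → M} {g : ∀ j a, S j a ⟶ T j a}
  {S' T' : ∀ j, α j → Under A} {g' : ∀ j a, S' j a ⟶ T' j a}
  (e : ∀ j a, Arrow.mk (g' j a) ≅ Arrow.mk ((Under.costar A).map (g j a)))
  {X : Under A} {Z : M} {f : X.right ⟶ Z}

/-- A relative cell complex in `M` starting at `X.right` lifts to a relative cell complex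
with free cells in `Under A`. -/
def relativeCellComplexUnder (c : RelativeCellComplex.{v} g f) :
    RelativeCellComplex.{v} g' (Under.homMk f : X ⟶ Under.mk (X.hom ≫ f)) where
  toTransfiniteCompositionOfShape :=
    transfiniteCompositionUnder c.toTransfiniteCompositionOfShape
  attachCells j hj := attachCellsUnder (e j) (c.attachCells j hj)

end Complexes

end FreeCells

/-- Compare `incl_ι` and `φ_bot` at stage `⊥`. This makes the inclusion of a subcomplex a map under
`A`. -/
lemma Subcomplex.hom_ι {C : Type u} [Category.{v} C] {K : Type v} [LinearOrder K] [OrderBot K]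
    [SuccOrder K] [WellFoundedLT K] {I : MorphismProperty C} {X Y : C} {f : X ⟶ Y}
    {c : RelativeCellComplex.{v} (fun _ : K ↦ I.homFamily) f} (s : Subcomplex c) :
    s.hom ≫ s.ι = f := by
  rw [← s.complex.fac, Category.assoc]
  refine (congrArg (_ ≫ ·) (s.incl_ι ⊥)).trans ?_
  rw [← Category.assoc, s.φ_bot]
  exact c.fac

/-! ### Free generating sets, compactness and smallness -/

noncomputable section FreeMaps

variable {M : Type u} [Category.{v} M] (A : M) [HasColimits M]

/-- The set of maps `A ⨿ X ⟶ A ⨿ Y` in `Under A`, for `X ⟶ Y` in `I`. -/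
def freeMaps (I : MorphismProperty M) : MorphismProperty (Under A) :=
  MorphismProperty.ofHoms fun i : I.toSet ↦ (Under.costar A).map (I.homFamily i)

instance (I : MorphismProperty M) [MorphismProperty.IsSmall.{v} I] :
    MorphismProperty.IsSmall.{v} (freeMaps A I) := by
  unfold freeMaps; infer_instance

lemma rlp_freeMaps (I : MorphismProperty M) : (freeMaps A I).rlp = I.rlp.under := by
  ext X Y f
  constructor
  · intro hf B C i hi
    have : HasLiftingProperty ((Under.costar A).map i) f :=
      hf _ (MorphismProperty.ofHoms.mk (⟨Arrow.mk i, hi⟩ : I.toSet))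
    exact ((Under.costarAdjForget A).hasLiftingProperty_iff i f).1 this
  · rintro hf _ _ _ ⟨i⟩
    exact ((Under.costarAdjForget A).hasLiftingProperty_iff i.1.hom f).2 (hf _ i.2)

variable {A} {I : MorphismProperty M}

/-- An element of `I` on which a given element of `freeMaps A I` is free. -/
def freeBasis (a : (freeMaps A I).toSet) : I.toSet :=
  ((MorphismProperty.ofHoms_iff _ _).1 a.2).choose

/-- An element of `freeMaps A I` is free on its basis. -/
def freeBasisIso (a : (freeMaps A I).toSet) :
    Arrow.mk ((freeMaps A I).homFamily a) ≅
      Arrow.mk ((Under.costar A).map (I.homFamily (freeBasis a))) :=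
  eqToIso ((MorphismProperty.ofHoms_iff _ _).1 a.2).choose_spec

section Compact

variable {K : Type v} [LinearOrder K] [OrderBot K] [SuccOrder K] [WellFoundedLT K]
  {X Y : Under A} {f : X ⟶ Y}

/-- The relative `I`-cell complex underlying a relative `freeMaps A I`-cell complex. -/
def cellComplexForget (c : RelativeCellComplex.{v} (fun _ : K ↦ (freeMaps A I).homFamily) f) :
    RelativeCellComplex.{v} (fun _ : K ↦ I.homFamily) f.right :=
  relativeCellComplexForget (fun _ ↦ freeBasis) (fun _ ↦ freeBasisIso) c

lemma cellComplexForget_incl_app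
    (c : RelativeCellComplex.{v} (fun _ : K ↦ (freeMaps A I).homFamily) f) (j : K) :
    (cellComplexForget c).incl.app j = (c.incl.app j).right :=
  Category.comp_id _

lemma cellComplexForget_attaching_map
    (c : RelativeCellComplex.{v} (fun _ : K ↦ (freeMaps A I).homFamily) f) (j : K)
    (hj : ¬ IsMax j) (i : (c.attachCells j hj).ι) :
    ((cellComplexForget c).attachCells j hj).cofan₁.inj i ≫
      ((cellComplexForget c).attachCells j hj).g₁ =
      transpose ((freeBasisIso ((c.attachCells j hj).π i)).inv.left ≫
        (c.attachCells j hj).cofan₁.inj i ≫ (c.attachCells j hj).g₁) :=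
  attachCellsForget_attaching_map freeBasis freeBasisIso (c.attachCells j hj) i

lemma cellComplexForget_cell
    (c : RelativeCellComplex.{v} (fun _ : K ↦ (freeMaps A I).homFamily) f) (j : K)
    (hj : ¬ IsMax j) (i : (c.attachCells j hj).ι) :
    ((cellComplexForget c).attachCells j hj).cell i =
      transpose ((freeBasisIso ((c.attachCells j hj).π i)).inv.right ≫
        (c.attachCells j hj).cell i) :=
  attachCellsForget_cell freeBasis freeBasisIso (c.attachCells j hj) i

variable (c : RelativeCellComplex.{v} (fun _ : K ↦ (freeMaps A I).homFamily) f)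
  (s : Subcomplex (cellComplexForget c))

/-- The presentation in `Under A` of a subcomplex of the underlying relative cell complex. -/
def subcomplexUnderComplex : RelativeCellComplex.{v}
    (fun (j : K) (a : (hj : ¬ IsMax j) ×' (c.attachCells j hj).ι) ↦
      (freeMaps A I).homFamily ((c.attachCells j a.1).π a.2))
    (Under.homMk s.hom : X ⟶ Under.mk (X.hom ≫ s.hom)) :=
  relativeCellComplexUnder (fun j a ↦ freeBasisIso ((c.attachCells j a.1).π a.2)) s.complex

/-- The map of sequences in `Under A` given by a subcomplex of the underlying relative cell
complex. -/
def subcomplexUnderMap : (subcomplexUnderComplex c s).F ⟶ c.F where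
  app j := Under.homMk (s.φ.app j) (by
    -- Both maps from `A` pass through stage `⊥`, where `s.φ_bot` identifies them.
    have h₁ := s.φ.naturality (homOfLE (bot_le : ⊥ ≤ j))
    have h₂ : _ ≫ s.φ.app ⊥ = c.isoBot.inv.right := s.φ_bot
    change (X.hom ≫ s.complex.isoBot.inv ≫ s.complex.F.map _) ≫ s.φ.app j = _
    rw [Category.assoc, Category.assoc, h₁, ← Category.assoc _ (s.φ.app ⊥), h₂]
    exact ((Category.assoc _ _ _).symm.trans (congrArg (· ≫ _) (Under.w c.isoBot.inv))).trans
      (Under.w (c.F.map (homOfLE (bot_le : ⊥ ≤ j)))))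
  naturality i j φ := by ext; exact s.φ.naturality φ

attribute [local irreducible] transpose freeBasis freeBasisIso freeMaps Under.costar

lemma subcomplexUnder_attaching_map (j : K) (hj : ¬ IsMax j)
    (i : (s.complex.attachCells j hj).ι) :
    (((subcomplexUnderComplex c s).attachCells j hj).cofan₁.inj i ≫
      ((subcomplexUnderComplex c s).attachCells j hj).g₁) ≫ (subcomplexUnderMap c s).app j =
      (c.attachCells j hj).cofan₁.inj ((s.complex.attachCells j hj).π i).2 ≫
        (c.attachCells j hj).g₁ :=
  attachCellsUnder_attaching_map_comp
    (f := (subcomplexUnderComplex c s).F.map (homOfLE (Order.le_succ j)))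
    (fun a : (hj : ¬ IsMax j) ×' (c.attachCells j hj).ι ↦
      freeBasisIso ((c.attachCells j a.1).π a.2)) (s.complex.attachCells j hj) i
    ((subcomplexUnderMap c s).app j)
    ((c.attachCells j hj).cofan₁.inj ((s.complex.attachCells j hj).π i).2 ≫
        (c.attachCells j hj).g₁)
    ((s.attaching_map j hj i).trans (cellComplexForget_attaching_map c j hj _))

lemma subcomplexUnder_cell (j : K) (hj : ¬ IsMax j) (i : (s.complex.attachCells j hj).ι) :
    (((subcomplexUnderComplex c s).attachCells j hj).cofan₂.inj i ≫
      ((subcomplexUnderComplex c s).attachCells j hj).g₂) ≫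
      (subcomplexUnderMap c s).app (Order.succ j) =
      (c.attachCells j hj).cell ((s.complex.attachCells j hj).π i).2 :=
  attachCellsUnder_cell_comp
    (f := (subcomplexUnderComplex c s).F.map (homOfLE (Order.le_succ j)))
    (fun a : (hj : ¬ IsMax j) ×' (c.attachCells j hj).ι ↦
      freeBasisIso ((c.attachCells j a.1).π a.2)) (s.complex.attachCells j hj) i
    ((subcomplexUnderMap c s).app (Order.succ j))
    ((c.attachCells j hj).cell ((s.complex.attachCells j hj).π i).2)
    ((s.characteristic_map j hj i).trans (cellComplexForget_cell c j hj _))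

/-- A subcomplex of the underlying relative cell complex lifts to `Under A`. -/
def subcomplexUnder : Subcomplex c where
  Z := Under.mk (X.hom ≫ s.hom)
  hom := Under.homMk s.hom
  complex := subcomplexUnderComplex c s
  π_injective := s.π_injective
  φ := subcomplexUnderMap c s
  φ_bot := by ext; exact s.φ_bot
  attaching_map := subcomplexUnder_attaching_map c s
  characteristic_map := subcomplexUnder_cell c s
  ι := Under.homMk s.ι (by
    change (X.hom ≫ s.hom) ≫ s.ι = Y.hom
    rw [Category.assoc, s.hom_ι, Under.w])
  incl_ι j := by
    ext
    exact (s.incl_ι j).trans (congrArg (_ ≫ ·) (cellComplexForget_incl_app c j))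

/-- A map from the free object on `W` is a map from `W` in `M`. It factors through a subcomplex
there, which lifts to `Under A`; the same `γ` works. -/
lemma isCompactRelativeTo_costar {W : M} (h : IsCompactRelativeTo W I) :
    IsCompactRelativeTo ((Under.costar A).obj W) (freeMaps A I) := by
  obtain ⟨γ, h⟩ := h
  refine ⟨γ, fun K _ _ _ _ X Y f c g ↦ ?_⟩
  obtain ⟨s, hs, l, hl⟩ := h K _ _ _ (cellComplexForget c) (transpose g)
  refine ⟨subcomplexUnder c s, ?_, transpose.symm l, ?_⟩
  -- The lifted subcomplex has the same cells, merely repackaged.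
  · refine le_trans (Cardinal.mk_le_of_injective
      (f := fun x ↦ (⟨x.j, x.hj, x.k⟩ : s.complex.Cells)) ?_) hs
    rintro ⟨j, hj, k⟩ ⟨j', hj', k'⟩ hx
    cases hx
    rfl
  · exact (transpose_symm_comp l (subcomplexUnder c s).ι).trans
      (transpose.symm_apply_eq.2 hl)

end Compact

section Small

lemma relativeCells_freeMaps_le :
    relativeCells (freeMaps A I) ≤ (relativeCells I).under := by
  intro X Y f hf
  obtain ⟨K, _, _, _, _, ⟨h⟩⟩ := (MorphismProperty.transfiniteCompositions_iff _ _).1 hf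
  refine (MorphismProperty.transfiniteCompositions_iff _ _).2 ⟨K, ‹_›, ‹_›, ‹_›, ‹_›, ⟨?_⟩⟩
  refine MorphismProperty.TransfiniteCompositionOfShape.map (F := Under.forget A) (h.ofLE ?_)
  rintro B C f ⟨_, _, _, _, _, ⟨i⟩, sq⟩
  exact ⟨_, _, _, _, _, i.2, isPushout_transpose sq⟩

/-- By adjunction, `Hom` out of the free object on `W` is the forgetful functor followed by `Hom(W,
-)`. The first preserves the colimit by connectedness, the second by smallness of `W`; the same `κ`
works. -/
lemma isSmallRelativeTo_costar {W : M} (h : IsSmallRelativeTo W (relativeCells I)) :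
    IsSmallRelativeTo ((Under.costar A).obj W) (relativeCells (freeMaps A I)) := by
  obtain ⟨κ, h⟩ := h
  refine ⟨κ, fun μ hμ hκ F hF hD ↦ ?_⟩
  have : Nonempty μ.ord.ToType := by
    rw [← Cardinal.mk_ne_zero_iff, Cardinal.mk_ord_toType]
    exact hμ.pos.ne'
  have : IsConnected μ.ord.ToType := IsFiltered.isConnected _
  have := h μ hμ hκ (F ⋙ Under.forget A) inferInstance
    (fun β ↦ relativeCells_freeMaps_le _ (hD β))
  have : PreservesColimit F (Under.forget A ⋙ coyoneda.obj (op W)) := inferInstance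
  exact preservesColimit_of_natIso F
    (NatIso.ofComponents (fun B ↦ transpose.symm.toIso) (fun {B C} f ↦ by
      ext x
      exact (transpose_symm_comp x f).symm) :
        Under.forget A ⋙ coyoneda.obj (op W) ≅ coyoneda.obj (op ((Under.costar A).obj W)))

end Small

section Generated

variable [ModelCategory M] {J : MorphismProperty M}

lemma isCofibrantlyGeneratedBy_freeMaps (h : IsCofibrantlyGeneratedBy I J) :
    IsCofibrantlyGeneratedBy (freeMaps A I) (freeMaps A J) where
  isSmall_I := by
    have := h.isSmall_I
    infer_instance
  isSmall_J := by
    have := h.isSmall_J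
    infer_instance
  small_dom_I := by
    rintro _ _ _ ⟨i⟩
    exact isSmallRelativeTo_costar (h.small_dom_I _ i.2)
  small_dom_J := by
    rintro _ _ _ ⟨j⟩
    exact isSmallRelativeTo_costar (h.small_dom_J _ j.2)
  fibrations_eq := by rw [rlp_freeMaps, ← h.fibrations_eq, fibrations_under]
  trivialFibrations_eq := by
    rw [rlp_freeMaps, ← h.trivialFibrations_eq, trivialFibrations_under]

lemma isCellularBy_freeMaps (h : IsCellularBy I J) :
    IsCellularBy (freeMaps A I) (freeMaps A J) where
  toIsCofibrantlyGeneratedBy := isCofibrantlyGeneratedBy_freeMaps h.toIsCofibrantlyGeneratedBy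
  compact_I := by
    rintro _ _ _ ⟨i⟩
    exact (h.compact_I _ i.2).imp isCompactRelativeTo_costar isCompactRelativeTo_costar
  compact_J := by
    rintro _ _ _ ⟨j⟩
    exact (h.compact_J _ j.2).imp isCompactRelativeTo_costar isCompactRelativeTo_costar
  small_dom_J_I := by
    rintro _ _ _ ⟨j⟩
    exact isSmallRelativeTo_costar (h.small_dom_J_I _ j.2)
  effectiveMono _ _ f hf := isEffectiveMono_under f (h.effectiveMono _ hf)

end Generated

end FreeMaps

end UnderModel

theorem mainTheorem8 (M : Type u) [Category.{v} M] [ModelCategory M]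
    [HasLimits M] [HasColimits M] (A : M) :
    HasLimits (Under A) ∧ HasColimits (Under A) ∧
    ∃ _ : ModelCategory (Under A),
      (∀ ⦃B C : Under A⦄ (f : B ⟶ C),
        (weakEquivalences (Under A) f ↔ weakEquivalences M f.right) ∧
        (cofibrations (Under A) f ↔ cofibrations M f.right) ∧
        (fibrations (Under A) f ↔ fibrations M f.right)) ∧
      (UnderModel.HasFunctorialFactorizations M →
        UnderModel.HasFunctorialFactorizations (Under A)) ∧
      (UnderModel.IsProper M → UnderModel.IsProper (Under A)) ∧
      (UnderModel.IsCofibrantlyGenerated M → UnderModel.IsCofibrantlyGenerated (Under A)) ∧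
      (UnderModel.IsCellular M → UnderModel.IsCellular (Under A)) := by
  refine ⟨inferInstance, inferInstance, UnderModel.modelCategoryUnder A,
    fun _ _ _ ↦ ⟨Iff.rfl, Iff.rfl, Iff.rfl⟩,
    UnderModel.hasFunctorialFactorizations_under A, UnderModel.isProper_under A, ?_, ?_⟩
  · rintro ⟨I, J, h⟩
    exact ⟨_, _, UnderModel.isCofibrantlyGeneratedBy_freeMaps h⟩
  · rintro ⟨I, J, h⟩
    exact ⟨_, _, UnderModel.isCellularBy_freeMaps h⟩
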